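/- Let $\mathbb{T}^d=\mathbb{R}^d/\mathbb{Z}^d$ with Lebesgue measure, let $\alpha\in(0,2]$ and let the dimension $d$ satisfy $d>\alpha$. The operator $(-\Delta)^{\beta/2}$ on $\mathbb{T}^d$ is the Fourier multiplier by $(2\pi|k|)^{\beta}$, $k\in\mathbb{Z}^d$. For $0<h<d/2$, let $S_h(\mathbb{T}^d)$ be the constant of the Sobolev embedding on average-free functions: $$S_{h}(\mathbb{T}^d)^{-1}=\sup\Big\{\|f\|_{L^{2d/(d-2h)}(\mathbb{T}^d)}^2\;;\; f\in L^2(\mathbb{T}^d)\text{ real-valued},\ \int_{\mathbb{T}^d}f=0,\ \int_{\mathbb{T}^d}|(-\Delta)^{h/2}f|^2=1\Big\}.$$ Let $T\ge 0$ and let $\mathbf{v}:(0,T)\times\mathbb{T}^d\to\mathbb{R}^d$ be measurable with, for almost every $s$, $\mathbf{v}(s)\in L^2(\mathbb{T}^d)$ and a distributional divergence $\operatorname{div}\mathbf{v}(s)\in L^1(\mathbb{T}^d)$ (measurable in $(s,x)$). Write $x_-=\max\{-x,0\}$ and assume $$\|(\operatorname{div}\mathbf{v})_-\|_{L^\infty(0,T;L^{d/\alpha}(\mathbb{T}^d))}\le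 S_{\alpha/2}(\mathbb{T}^d).$$ Let $\psi$ be a real-valued solution on $[0,T]\times\mathbb{T}^d$ of $$\partial_s\psi+(-\Delta)^{\alpha/2}\psi=-\operatorname{div}(\mathbf{v}\psi),\qquad \psi(0)=\psi_0,$$ in the following sense: $\psi\in C([0,T];L^2(\mathbb{T}^d))$, $\psi\in L^2_{\mathrm{loc}}((0,T];H^1(\mathbb{T}^d))$, $\mathbf{v}\psi\in L^2_{\mathrm{loc}}((0,T];L^2(\mathbb{T}^d))$, the equation holds in the sense of distributions on $(0,T)\times\mathbb{T}^d$, and $\psi(0)=\psi_0$ almost everywhere. Classical solutions are of this kind. Assume that $\psi$ is average-free, i.e. $\int_{\mathbb{T}^d}\psi(s,x)\,dx=0$ for all $s\in[0,T]$. Then, for every $s\in[0,T]$, $$\|\psi(s)\|_{L^2}^2+S_{\alpha/2}(\mathbb{T}^d)\int_0^s\|\psi(\tau)\|_{L^\sigma}^2\,d\tau\le\|\psi_0\|_{L^2}^2\qquad\text{with}\qquad\sigma=\frac{2d}{d-\alpha}.$$ -/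

import Mathlib

open MeasureTheory Filter Topology
open scoped ENNReal ContDiff

namespace PeriodicTransportDiffusion

noncomputable section

/-- Lebesgue measure on the torus `𝕋^d = ℝ^d / ℤ^d` (of total mass one). It is the measure with
respect to which the Fourier coefficients `UnitAddTorus.mFourierCoeff` are computed. -/
abbrev torusMeasure (d : ℕ) : Measure (UnitAddTorus (Fin d)) :=
  Measure.pi fun _ => (AddCircle.haarAddCircle : Measure UnitAddCircle)

/-- The `k`-th Fourier coefficient `∫ f(x) exp(-2πi k·x) dx` of a real function on the torus. -/
def coeff {d : ℕ} (f : UnitAddTorus (Fin d) → ℝ) (k : Fin d → ℤ) : ℂ :=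
  UnitAddTorus.mFourierCoeff (fun x => (f x : ℂ)) k

/-- The Euclidean length `|ξ| = 2π|k|` of the frequency `ξ = 2πk` of the mode `exp(2πi k·x)`.
The operator `(-Δ)^{β/2}` is the Fourier multiplier by `|ξ|^β`. -/
def freq {d : ℕ} (k : Fin d → ℤ) : ℝ :=
  2 * Real.pi * Real.sqrt (∑ j, (k j : ℝ) ^ 2)

/-- `∫ |(-Δ)^{h/2} f|² = ∑_k |ξ_k|^{2h} |f̂(k)|²`, the square of the homogeneous Sobolev norm of
`Ḣ^h(𝕋^d)`, as an element of `[0, ∞]`. For `h = 1` this is `∫ |∇f|²`. -/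
def homSobolevSq {d : ℕ} (h : ℝ) (f : UnitAddTorus (Fin d) → ℝ) : ℝ≥0∞ :=
  ∑' k : Fin d → ℤ, ENNReal.ofReal (freq k ^ (2 * h) * ‖coeff f k‖ ^ 2)

/-- The Sobolev constant `S_h(𝕋^d)`: its inverse is the supremum of `‖f‖²` in `L^{2d/(d-2h)}` over
the average-free `f` in `Ḣ^h(𝕋^d)` with `∫ |(-Δ)^{h/2} f|² = 1`. -/
def sobolevConst (d : ℕ) (h : ℝ) : ℝ≥0∞ :=
  (⨆ (f : UnitAddTorus (Fin d) → ℝ) (_ : MemLp f 2 (torusMeasure d))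
    (_ : ∫ x, f x ∂(torusMeasure d) = 0) (_ : homSobolevSq h f = 1),
    eLpNorm f (ENNReal.ofReal (2 * d / (d - 2 * h))) (torusMeasure d) ^ 2)⁻¹

/-- Smooth functions on the torus: the periodic lift to `ℝ^d` is smooth. -/
def IsTestFunction {d : ℕ} (φ : UnitAddTorus (Fin d) → ℝ) : Prop :=
  ContDiff ℝ ∞ fun y : Fin d → ℝ => φ fun i => (y i : UnitAddCircle)

/-- The partial derivative `∂_j φ` on the torus. -/
def torusPartial {d : ℕ} (j : Fin d) (φ : UnitAddTorus (Fin d) → ℝ)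
    (x : UnitAddTorus (Fin d)) : ℝ :=
  deriv (fun t : ℝ => φ (x + Pi.single j (t : UnitAddCircle))) 0

/-- `div u = g` in the sense of distributions on the torus, where `u` and `g` are integrable. -/
structure HasWeakDiv {d : ℕ} (u : UnitAddTorus (Fin d) → Fin d → ℝ)
    (g : UnitAddTorus (Fin d) → ℝ) : Prop where
  integrable_field : ∀ j, Integrable (fun x => u x j) (torusMeasure d)
  integrable_div : Integrable g (torusMeasure d)
  integral_eq : ∀ φ : UnitAddTorus (Fin d) → ℝ, IsTestFunction φ →
    ∫ x, ∑ j, u x j * torusPartial j φ x ∂(torusMeasure d) =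
      - ∫ x, g x * φ x ∂(torusMeasure d)

/-- Advection fields on `(0, T) × 𝕋^d`: measurable, square integrable in space at almost every time,
with spatial divergence (in the sense of distributions) the integrable function `divv`. -/
structure IsAdvectionField {d : ℕ} (T : ℝ) (v : ℝ → UnitAddTorus (Fin d) → Fin d → ℝ)
    (divv : ℝ → UnitAddTorus (Fin d) → ℝ) : Prop where
  measurable_field : ∀ j, AEStronglyMeasurable
    (fun p : ℝ × UnitAddTorus (Fin d) => v p.1 p.2 j)
    ((volume.restrict (Set.Ioc 0 T)).prod (torusMeasure d))
  measurable_div : AEStronglyMeasurable (fun p : ℝ × UnitAddTorus (Fin d) => divv p.1 p.2)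
    ((volume.restrict (Set.Ioc 0 T)).prod (torusMeasure d))
  memLp_field : ∀ᵐ τ ∂(volume.restrict (Set.Ioc 0 T)), ∀ j,
    MemLp (fun x => v τ x j) 2 (torusMeasure d)
  hasWeakDiv : ∀ᵐ τ ∂(volume.restrict (Set.Ioc 0 T)), HasWeakDiv (v τ) (divv τ)

/-- `ψ` solves `∂_s ψ + (-Δ)^{α/2} ψ = - div(v ψ)` on `[0, T] × 𝕋^d`, with `ψ(0) = ψ₀`.

The solution is continuous in time with values in `L²`, including at time zero; for positive times
it belongs to `L²_loc((0, T]; H¹)`, with a flux `v ψ` in `L²_loc((0, T]; L²)`. No regularity beyond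
`L²` is required at time zero. All classical solutions are of this kind.

The equation holds in the sense of distributions. It is written in its time-integrated form and
tested in space on the Fourier modes `exp(-2πi k·x)`, which span a dense subspace of the smooth
functions; the factor `2πi k_j` is the symbol of `∂_j`. -/
structure IsSolution {d : ℕ} (α T : ℝ) (v : ℝ → UnitAddTorus (Fin d) → Fin d → ℝ)
    (ψ₀ : UnitAddTorus (Fin d) → ℝ) (ψ : ℝ → UnitAddTorus (Fin d) → ℝ) : Prop where
  measurable : AEStronglyMeasurable (fun p : ℝ × UnitAddTorus (Fin d) => ψ p.1 p.2)
    ((volume.restrict (Set.Ioc 0 T)).prod (torusMeasure d))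
  memLp : ∀ s ∈ Set.Icc 0 T, MemLp (ψ s) 2 (torusMeasure d)
  continuous : ∀ s ∈ Set.Icc 0 T,
    Tendsto (fun r => eLpNorm (ψ r - ψ s) 2 (torusMeasure d)) (𝓝[Set.Icc 0 T] s) (𝓝 0)
  initial : ψ 0 =ᵐ[torusMeasure d] ψ₀
  gradient : ∀ δ > 0, ∫⁻ τ in Set.Ioc δ T, homSobolevSq 1 (ψ τ) < ⊤
  flux : ∀ δ > 0, ∀ j,
    ∫⁻ τ in Set.Ioc δ T, eLpNorm (fun x => v τ x j * ψ τ x) 2 (torusMeasure d) ^ 2 < ⊤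
  equation : ∀ r s : ℝ, 0 < r → r ≤ s → s ≤ T → ∀ k : Fin d → ℤ,
    coeff (ψ s) k - coeff (ψ r) k =
      ∫ τ in r..s, (- ((freq k ^ α : ℝ) : ℂ) * coeff (ψ τ) k
        - ∑ j, 2 * Real.pi * Complex.I * (k j : ℂ) * coeff (fun x => v τ x j * ψ τ x) k)

end

end PeriodicTransportDiffusion

/-!
The formal computation multiplies the equation by `2ψ`:
`d/ds ‖ψ‖² = -2 ‖(-Δ)^{α/4} ψ‖² + 2 ∫ ψ v · ∇ψ`, where
`2 ∫ ψ v · ∇ψ = -∫ (div v) ψ² ≤ ∫ (div v)_- ψ² ≤ ‖(div v)_-‖_{L^{d/α}} ‖ψ‖²_{L^σ}`.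
By hypothesis the last expression is at most `S ‖ψ‖²_{L^σ}`, hence at most `‖(-Δ)^{α/4} ψ‖²` by the
Sobolev inequality for average-free functions (`sobolevConst_mul_eLpNorm_sq_le`). Thus
`d/ds ‖ψ‖² ≤ -‖(-Δ)^{α/4} ψ‖² ≤ -S ‖ψ‖²_{L^σ}`.

Three points need care. First, `div v` is only integrable while `ψ²` is only in `W^{1,1}`, so the
integration by parts is done with the bounded functions `ψ² / (1 + ε ψ²)`; these are limits of
smooth functions of the Fourier partial sums of `ψ`, which are admissible in the weak formulation
of the divergence (`HasWeakDiv.integral_comp`, `ofReal_integral_transport_le`). Second, the energy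
identity is derived from the equation mode by mode: each Fourier coefficient is absolutely
continuous in time, which gives the chain rule for its square
(`norm_sq_sub_norm_sq_eq_intervalIntegral`), and by Parseval's identity the sum over the modes
converges absolutely in `L¹(r, s)` for `r > 0`, because `∇ψ` and `vψ` are in `L²` there
(`IsSolution.energy_le`). Third, nothing beyond `L²` is known at time zero, and the inequality on
`[0, s]` follows from the one on `[r, s]` by continuity in `L²` and monotone convergence as `r → 0`.
-/

namespace PeriodicTransportDiffusion

open UnitAddTorus ComplexConjugate

noncomputable section

variable {d : ℕ}

/-! ### Fourier series of real functions on the torus -/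

lemma coeff_eq_integral (f : UnitAddTorus (Fin d) → ℝ) (k : Fin d → ℤ) :
    coeff f k = ∫ x, mFourier (-k) x * (f x : ℂ) ∂(torusMeasure d) := rfl

/-- The real part of the trigonometric polynomial with coefficients `c k`, `k ∈ K`. -/
def realTrigPoly (K : Finset (Fin d → ℤ)) (c : (Fin d → ℤ) → ℂ)
    (x : UnitAddTorus (Fin d)) : ℝ :=
  (∑ k ∈ K, c k * mFourier k x).re

lemma continuous_realTrigPoly (K : Finset (Fin d → ℤ)) (c : (Fin d → ℤ) → ℂ) :
    Continuous (realTrigPoly K c) := by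
  unfold realTrigPoly
  fun_prop

section L2

variable (Φ : Lp ℂ 2 (torusMeasure d))

lemma tendsto_realTrigPoly_mFourierCoeff :
    Tendsto (fun K => eLpNorm (fun x => realTrigPoly K (mFourierCoeff Φ) x - (Φ x).re) 2
      (torusMeasure d)) atTop (𝓝 0) := by
  have h : HasSum (fun i ↦ mFourierCoeff Φ i • mFourierLp 2 i) Φ := hasSum_mFourier_series_L2 Φ
  have h2 := (Lp.tendsto_Lp_iff_tendsto_eLpNorm' _ _).1 h
  refine tendsto_of_tendsto_of_tendsto_of_le_of_le tendsto_const_nhds h2 (fun _ => zero_le) ?_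
  intro K
  -- a representative of the partial sum in `Lp`
  have key : ∀ K : Finset (Fin d → ℤ),
      (((∑ i ∈ K, mFourierCoeff Φ i • mFourierLp 2 i : Lp ℂ 2 (torusMeasure d))) : _ → ℂ)
        =ᵐ[torusMeasure d] fun x => ∑ k ∈ K, mFourierCoeff Φ k * mFourier k x := by
    intro K
    induction K using Finset.induction_on with
    | empty => simpa using! Lp.coeFn_zero ℂ 2 (torusMeasure d)
    | insert k K hk ih =>
      simp only [Finset.sum_insert hk]
      filter_upwards [Lp.coeFn_add (mFourierCoeff Φ k • mFourierLp 2 k : Lp ℂ 2 (torusMeasure d))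
        (∑ i ∈ K, mFourierCoeff Φ i • mFourierLp 2 i), ih,
        Lp.coeFn_smul (mFourierCoeff Φ k) (mFourierLp 2 k : Lp ℂ 2 (torusMeasure d)),
        (coeFn_mFourierLp 2 k : _ =ᵐ[torusMeasure d] _)] with x h1 h2 h3 h4
      rw [h1, Pi.add_apply, h2, h3, Pi.smul_apply, h4, smul_eq_mul]
  refine eLpNorm_mono_ae ?_
  filter_upwards [key K] with x hx
  simp only [Pi.sub_apply, hx, realTrigPoly, ← Complex.sub_re]
  exact Complex.abs_re_le_norm _

lemma hasSum_re_conj_mFourierCoeff_mul_coeff {F : UnitAddTorus (Fin d) → ℝ}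
    (hF : MemLp F 2 (torusMeasure d)) :
    HasSum (fun k => (conj (mFourierCoeff Φ k) * coeff F k).re)
      (∫ x, (Φ x).re * F x ∂(torusMeasure d)) := by
  have hG : MemLp (fun x => (F x : ℂ)) 2 (torusMeasure d) := hF.ofReal
  have h := hasSum_prod_mFourierCoeff Φ hG.toLp
  have h1 : ∀ k, mFourierCoeff (hG.toLp) k = coeff F k := fun k =>
    integral_congr_ae (by filter_upwards [hG.coeFn_toLp] with x hx; rw [hx])
  simp only [h1] at h
  have h2 := Complex.hasSum_re h
  have hi : Integrable (fun x => conj (Φ x) * (hG.toLp _ : Lp ℂ 2 (torusMeasure d)) x) (torusMeasure d) :=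
    ((Lp.memLp Φ).star).integrable_mul (Lp.memLp (hG.toLp _))
  convert! h2 using 1
  refine Eq.trans (integral_congr_ae ?_) (integral_re hi)
  filter_upwards [hG.coeFn_toLp] with x hx
  simp [hx]

end L2

/-- Riesz–Fischer for the real part: square summable coefficients `c` define a real `L²` function,
the limit of the trigonometric polynomials, whose pairings are computed by Parseval's identity. -/
lemma exists_memLp_of_summable_sq {c : (Fin d → ℤ) → ℂ} (hc : Summable fun k => ‖c k‖ ^ 2) :
    ∃ g : UnitAddTorus (Fin d) → ℝ, MemLp g 2 (torusMeasure d) ∧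
      Tendsto (fun K => eLpNorm (fun x => realTrigPoly K c x - g x) 2 (torusMeasure d))
        atTop (𝓝 0) ∧
      ∀ F : UnitAddTorus (Fin d) → ℝ, MemLp F 2 (torusMeasure d) →
        HasSum (fun k => (conj (c k) * coeff F k).re) (∫ x, g x * F x ∂(torusMeasure d)) := by
  have hc' : Memℓp c 2 := by
    refine memℓp_gen ?_
    simpa using hc
  let Φ : Lp ℂ 2 (torusMeasure d) := mFourierBasis.repr.symm ⟨c, hc'⟩
  have hΦ : mFourierCoeff Φ = c := by
    ext k
    have := mFourierBasis_repr (d := Fin d) Φ k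
    rw [← this]
    simp [Φ]
  refine ⟨fun x => (Φ x).re, (Lp.memLp Φ).re, ?_, fun F hF => ?_⟩
  · simpa only [hΦ] using tendsto_realTrigPoly_mFourierCoeff Φ
  · simpa only [hΦ] using hasSum_re_conj_mFourierCoeff_mul_coeff Φ hF

/-- Taking real parts of the complex partial sums suffices: `f` is real, so no symmetry of the
index sets is needed. -/
lemma tendsto_realTrigPoly_coeff {f : UnitAddTorus (Fin d) → ℝ} (hf : MemLp f 2 (torusMeasure d)) :
    Tendsto (fun K => eLpNorm (fun x => realTrigPoly K (coeff f) x - f x) 2 (torusMeasure d))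
      atTop (𝓝 0) := by
  have hG : MemLp (fun x => (f x : ℂ)) 2 (torusMeasure d) := hf.ofReal
  have h1 : mFourierCoeff (hG.toLp) = coeff f := funext fun k =>
    integral_congr_ae (by filter_upwards [hG.coeFn_toLp] with x hx; rw [hx])
  have h := tendsto_realTrigPoly_mFourierCoeff hG.toLp
  rw [h1] at h
  refine h.congr fun K => eLpNorm_congr_ae ?_
  filter_upwards [hG.coeFn_toLp] with x hx
  simp [hx]

/-- Parseval's identity for real functions. -/
lemma hasSum_sq_coeff {f : UnitAddTorus (Fin d) → ℝ} (hf : MemLp f 2 (torusMeasure d)) :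
    HasSum (fun k => ‖coeff f k‖ ^ 2) (∫ x, f x ^ 2 ∂(torusMeasure d)) := by
  have hG : MemLp (fun x => (f x : ℂ)) 2 (torusMeasure d) := hf.ofReal
  have h1 : mFourierCoeff (hG.toLp) = coeff f := funext fun k =>
    integral_congr_ae (by filter_upwards [hG.coeFn_toLp] with x hx; rw [hx])
  have h := hasSum_sq_mFourierCoeff hG.toLp
  rw [h1] at h
  convert! h using 1
  refine integral_congr_ae ?_
  filter_upwards [hG.coeFn_toLp] with x hx
  simp [hx]

lemma eLpNorm_two_sq {f : UnitAddTorus (Fin d) → ℝ} (hf : MemLp f 2 (torusMeasure d)) :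
    eLpNorm f 2 (torusMeasure d) ^ 2 = ENNReal.ofReal (∫ x, f x ^ 2 ∂(torusMeasure d)) := by
  rw [hf.eLpNorm_eq_integral_rpow_norm (by simp) (by simp), ← ENNReal.ofReal_pow (by positivity)]
  congr 1
  simp only [ENNReal.toReal_ofNat, Real.rpow_two, Real.norm_eq_abs, sq_abs]
  rw [← one_div, ← Real.sqrt_eq_rpow, Real.sq_sqrt (integral_nonneg fun x => sq_nonneg _)]

lemma tsum_ofReal_sq_coeff {f : UnitAddTorus (Fin d) → ℝ} (hf : MemLp f 2 (torusMeasure d)) :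
    ∑' k, ENNReal.ofReal (‖coeff f k‖ ^ 2) = eLpNorm f 2 (torusMeasure d) ^ 2 := by
  rw [eLpNorm_two_sq hf, ← (hasSum_sq_coeff hf).tsum_eq,
    ENNReal.ofReal_tsum_of_nonneg (fun _ => by positivity) (hasSum_sq_coeff hf).summable]

lemma mFourier_add_single (k : Fin d → ℤ) (x : UnitAddTorus (Fin d)) (j : Fin d)
    (t : UnitAddCircle) :
    mFourier k (x + Pi.single j t) = mFourier k x * fourier (k j) t := by
  simp only [mFourier, ContinuousMap.coe_mk]
  rw [← Finset.mul_prod_erase _ _ (Finset.mem_univ j),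
    ← Finset.mul_prod_erase Finset.univ (fun i => fourier (k i) (x i)) (Finset.mem_univ j)]
  have : ∏ i ∈ Finset.univ.erase j, fourier (k i) ((x + Pi.single j t : UnitAddTorus (Fin d)) i)
      = ∏ i ∈ Finset.univ.erase j, fourier (k i) (x i) := by
    refine Finset.prod_congr rfl fun i hi => ?_
    simp [Pi.single_eq_of_ne (Finset.ne_of_mem_erase hi)]
  rw [this]
  simp only [Pi.add_apply, Pi.single_eq_same, fourier_apply, smul_add, AddCircle.toCircle_add,
    Circle.coe_mul]
  ring

lemma hasDerivAt_realTrigPoly (K : Finset (Fin d → ℤ)) (c : (Fin d → ℤ) → ℂ) (j : Fin d)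
    (x : UnitAddTorus (Fin d)) :
    HasDerivAt (fun t : ℝ => realTrigPoly K c (x + Pi.single j (t : UnitAddCircle)))
      (realTrigPoly K (fun k => 2 * Real.pi * Complex.I * (k j : ℂ) * c k) x) 0 := by
  unfold realTrigPoly
  simp only [mFourier_add_single]
  have h : HasDerivAt (fun t : ℝ => ∑ k ∈ K, c k * (mFourier k x * fourier (k j) (t : UnitAddCircle)))
      (∑ k ∈ K, 2 * Real.pi * Complex.I * (k j : ℂ) * c k * mFourier k x) 0 := by
    refine HasDerivAt.fun_sum fun k _ => ?_
    have := (((hasDerivAt_fourier 1 (k j) 0).const_mul (mFourier k x)).const_mul (c k))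
    refine this.congr_deriv ?_
    rw [show ((0 : ℝ) : AddCircle (1 : ℝ)) = 0 from rfl, fourier_eval_zero]
    push_cast
    ring
  exact (Complex.reCLM.hasFDerivAt.comp_hasDerivAt (0 : ℝ) h)

lemma isTestFunction_realTrigPoly (K : Finset (Fin d → ℤ)) (c : (Fin d → ℤ) → ℂ) :
    IsTestFunction (realTrigPoly K c) := by
  unfold IsTestFunction realTrigPoly
  refine Complex.reCLM.contDiff.comp ?_
  refine ContDiff.sum fun k _ => contDiff_const.mul ?_
  simp only [mFourier, ContinuousMap.coe_mk, fourier_coe_apply]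
  refine contDiff_prod fun i _ => Complex.contDiff_exp.comp ?_
  refine ContDiff.div_const (contDiff_const.mul ?_) _
  exact Complex.ofRealCLM.contDiff.comp (contDiff_apply ℝ ℝ i)

/-! ### Integration by parts against a field with integrable divergence -/

lemma IsTestFunction.comp {β : ℝ → ℝ} (hβ : ContDiff ℝ ∞ β) {φ : UnitAddTorus (Fin d) → ℝ}
    (hφ : IsTestFunction φ) : IsTestFunction fun x => β (φ x) :=
  ContDiff.comp hβ hφ

lemma torusPartial_comp_realTrigPoly {β β' : ℝ → ℝ} (hβ : ∀ t, HasDerivAt β (β' t) t)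
    (K : Finset (Fin d → ℤ)) (c : (Fin d → ℤ) → ℂ) (j : Fin d) (x : UnitAddTorus (Fin d)) :
    torusPartial j (fun x => β (realTrigPoly K c x)) x =
      β' (realTrigPoly K c x) *
        realTrigPoly K (fun k => 2 * Real.pi * Complex.I * (k j : ℂ) * c k) x := by
  have h := hasDerivAt_realTrigPoly K c j x
  have h0 : realTrigPoly K c (x + Pi.single j ((0 : ℝ) : UnitAddCircle)) = realTrigPoly K c x := by
    rw [show ((0 : ℝ) : UnitAddCircle) = 0 from rfl, Pi.single_zero, add_zero]
  have hb := hβ (realTrigPoly K c (x + Pi.single j ((0 : ℝ) : UnitAddCircle)))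
  have := (hb.comp (0 : ℝ) h).deriv
  rw [h0] at this
  exact this

lemma sq_freq (k : Fin d → ℤ) : freq k ^ 2 = ∑ j, (2 * Real.pi * (k j : ℝ)) ^ 2 := by
  rw [freq, mul_pow, Real.sq_sqrt (by positivity), Finset.mul_sum]
  simp only [mul_pow]

lemma freq_nonneg (k : Fin d → ℤ) : 0 ≤ freq k := by
  unfold freq; positivity

lemma norm_symbol_mul_sq (k : Fin d → ℤ) (j : Fin d) (z : ℂ) :
    ‖2 * Real.pi * Complex.I * (k j : ℂ) * z‖ ^ 2 = (2 * Real.pi * (k j : ℝ)) ^ 2 * ‖z‖ ^ 2 := by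
  simp [mul_pow, abs_of_pos Real.pi_pos]

/-- `g` is the gradient of `f` in `L²(𝕋^d)`: each `g j` is the `L²` limit of the `j`-th partial
derivatives of the Fourier partial sums of `f`, and pairs with real `L²` functions by Parseval's
identity, with `2πi k_j f̂(k)` as Fourier coefficients. -/
def IsL2Gradient (f : UnitAddTorus (Fin d) → ℝ) (g : Fin d → UnitAddTorus (Fin d) → ℝ) : Prop :=
  ∀ j, MemLp (g j) 2 (torusMeasure d) ∧
    Tendsto (fun K => eLpNorm (fun x => realTrigPoly K
      (fun k => 2 * Real.pi * Complex.I * (k j : ℂ) * coeff f k) x - g j x) 2 (torusMeasure d))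
      atTop (𝓝 0) ∧
    ∀ F : UnitAddTorus (Fin d) → ℝ, MemLp F 2 (torusMeasure d) →
      HasSum (fun k => (conj (2 * Real.pi * Complex.I * (k j : ℂ) * coeff f k) * coeff F k).re)
        (∫ x, g j x * F x ∂(torusMeasure d))

lemma summable_of_homSobolevSq_lt_top {h : ℝ} {f : UnitAddTorus (Fin d) → ℝ}
    (hf : homSobolevSq h f < ⊤) : Summable fun k => freq k ^ (2 * h) * ‖coeff f k‖ ^ 2 := by
  have := ENNReal.summable_toReal hf.ne
  refine this.congr fun k => ?_
  have := freq_nonneg k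
  rw [ENNReal.toReal_ofReal (by positivity)]

lemma exists_isL2Gradient {f : UnitAddTorus (Fin d) → ℝ} (hf : homSobolevSq 1 f < ⊤) :
    ∃ g, IsL2Gradient f g := by
  have hs := summable_of_homSobolevSq_lt_top hf
  have : ∀ j : Fin d, Summable fun k : Fin d → ℤ =>
      ‖2 * Real.pi * Complex.I * (k j : ℂ) * coeff f k‖ ^ 2 := by
    intro j
    refine Summable.of_nonneg_of_le (fun k => by positivity) (fun k => ?_) hs
    rw [norm_symbol_mul_sq]
    gcongr
    rw [mul_one, Real.rpow_two, sq_freq]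
    exact Finset.single_le_sum (f := fun j => (2 * Real.pi * (k j : ℝ)) ^ 2)
      (fun i _ => sq_nonneg _) (Finset.mem_univ j)
  choose g hg using fun j => exists_memLp_of_summable_sq (this j)
  exact ⟨g, hg⟩

lemma memLp_realTrigPoly (K : Finset (Fin d → ℤ)) (c : (Fin d → ℤ) → ℂ) (p : ℝ≥0∞) :
    MemLp (realTrigPoly K c) p (torusMeasure d) :=
  (continuous_realTrigPoly K c).memLp_of_hasCompactSupport (HasCompactSupport.of_compactSpace _)

/-- A strongly convergent factor and a boundedly a.e. convergent factor may be passed to the limit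
together against a fixed `L²` function. -/
lemma tendsto_integral_mul_mul {X : Type*} [MeasurableSpace X] {μ : Measure X}
    {v g w : X → ℝ} {gn wn : ℕ → X → ℝ} {C : ℝ}
    (hv : MemLp v 2 μ) (hg : MemLp g 2 μ) (hgn : ∀ n, MemLp (gn n) 2 μ)
    (hlim : Tendsto (fun n => eLpNorm (fun x => gn n x - g x) 2 μ) atTop (𝓝 0))
    (hwm : ∀ n, AEStronglyMeasurable (wn n) μ) (hwb : ∀ n x, |wn n x| ≤ C)
    (hw : ∀ᵐ x ∂μ, Tendsto (fun n => wn n x) atTop (𝓝 (w x))) :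
    Tendsto (fun n => ∫ x, v x * (wn n x * gn n x) ∂μ) atTop (𝓝 (∫ x, v x * (w x * g x) ∂μ)) := by
  have hwv : ∀ n, MemLp (fun x => v x * wn n x) 2 μ := fun n =>
    hv.of_le_mul (c := C) (hv.1.mul (hwm n)) (Eventually.of_forall fun x => by
      rw [norm_mul, mul_comm]
      exact mul_le_mul_of_nonneg_right (hwb n x) (norm_nonneg _))
  have h1 : Tendsto (fun n => ∫ x, (v x * wn n x) * (gn n x - g x) ∂μ) atTop
      (𝓝 (∫ x, (0 : ℝ) ∂μ)) := by
    refine tendsto_integral_of_L1' _ aestronglyMeasurable_const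
      (Eventually.of_forall fun n => (hwv n).integrable_mul ((hgn n).sub hg)) ?_
    have hC : Tendsto (fun n => ENNReal.ofReal C * eLpNorm v 2 μ *
        eLpNorm (fun x => gn n x - g x) 2 μ) atTop (𝓝 0) := by
      have := ENNReal.Tendsto.const_mul (a := ENNReal.ofReal C * eLpNorm v 2 μ) hlim
        (Or.inr (ENNReal.mul_ne_top ENNReal.ofReal_ne_top hv.2.ne))
      simpa using this
    refine tendsto_of_tendsto_of_tendsto_of_le_of_le tendsto_const_nhds hC (fun _ => zero_le) ?_
    intro n
    have h2 : eLpNorm (fun x => v x * wn n x * (gn n x - g x)) 1 μ ≤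
        eLpNorm (fun x => v x * wn n x) 2 μ * eLpNorm (fun x => gn n x - g x) 2 μ :=
      eLpNorm_smul_le_mul_eLpNorm (p := 2) (q := 2) (r := 1) (f := fun x => gn n x - g x)
        (φ := fun x => v x * wn n x) ((hgn n).1.sub hg.1) (hwv n).1
    have h3 : eLpNorm (fun x => v x * wn n x) 2 μ ≤ ENNReal.ofReal C * eLpNorm v 2 μ := by
      refine eLpNorm_le_mul_eLpNorm_of_ae_le_mul ?_ 2
      filter_upwards with x
      rw [norm_mul, mul_comm]
      exact mul_le_mul_of_nonneg_right (hwb n x) (norm_nonneg _)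
    simp only [← Pi.zero_def, sub_zero]
    exact h2.trans (by gcongr)
  have h4 : Tendsto (fun n => ∫ x, v x * (wn n x * g x) ∂μ) atTop
      (𝓝 (∫ x, v x * (w x * g x) ∂μ)) := by
    refine tendsto_integral_of_dominated_convergence (fun x => C * ‖v x * g x‖) (fun n => ?_)
      ((hv.integrable_mul hg).norm.const_mul C) (fun n => ?_) ?_
    · exact hv.1.mul ((hwm n).mul hg.1)
    · filter_upwards with x
      rw [show v x * (wn n x * g x) = wn n x * (v x * g x) by ring, norm_mul]
      exact mul_le_mul_of_nonneg_right (hwb n x) (norm_nonneg _)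
    · filter_upwards [hw] with x hx
      exact tendsto_const_nhds.mul (hx.mul tendsto_const_nhds)
  have h5 := h1.add h4
  simp only [integral_zero, zero_add] at h5
  refine h5.congr fun n => ?_
  have hi1 : Integrable (fun x => v x * wn n x * (gn n x - g x)) μ :=
    (hwv n).integrable_mul ((hgn n).sub hg)
  have hi2 : Integrable (fun x => v x * (wn n x * g x)) μ := by
    simpa only [← mul_assoc] using! (hwv n).integrable_mul hg
  rw [← integral_add hi1 hi2]
  exact integral_congr_ae (Eventually.of_forall fun x => by simp only; ring)

/-- The renormalised form of the weak divergence: a bounded smooth function `β` of an `H¹` function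
`f` is an admissible test function, with gradient `β'(f) ∇f`. It is approximated by `β` of the
Fourier partial sums of `f`, which are smooth. -/
lemma HasWeakDiv.integral_comp {v : UnitAddTorus (Fin d) → Fin d → ℝ}
    {q f : UnitAddTorus (Fin d) → ℝ} {g : Fin d → UnitAddTorus (Fin d) → ℝ} (hq : HasWeakDiv v q)
    (hv : ∀ j, MemLp (fun x => v x j) 2 (torusMeasure d)) (hf : MemLp f 2 (torusMeasure d))
    (hg : IsL2Gradient f g) {β β' : ℝ → ℝ} {C : ℝ} (hβ : ContDiff ℝ ∞ β)
    (hβ' : ∀ t, HasDerivAt β (β' t) t) (hC : ∀ t, |β t| ≤ C) (hC' : ∀ t, |β' t| ≤ C) :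
    ∑ j, ∫ x, v x j * (β' (f x) * g j x) ∂(torusMeasure d) =
      - ∫ x, q x * β (f x) ∂(torusMeasure d) := by
  have hcβ : Continuous β := hβ.continuous
  have hcβ' : Continuous β' := by
    have h : deriv β = β' := funext fun t => (hβ' t).deriv
    rw [← h]
    exact hβ.continuous_deriv (by simp)
  obtain ⟨K, hK, hae⟩ := (tendstoInMeasure_of_tendsto_eLpNorm (by simp)
    (fun n => (memLp_realTrigPoly n (coeff f) 2).1) hf.1
    (tendsto_realTrigPoly_coeff hf)).exists_seq_tendsto_ae'
  have hmem : ∀ n j, MemLp (realTrigPoly (K n)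
      (fun k => 2 * Real.pi * Complex.I * (k j : ℂ) * coeff f k)) 2 (torusMeasure d) :=
    fun n j => memLp_realTrigPoly _ _ _
  have hm : ∀ n, AEStronglyMeasurable (fun x => β' (realTrigPoly (K n) (coeff f) x))
      (torusMeasure d) := fun n =>
    (hcβ'.comp (continuous_realTrigPoly _ _)).aestronglyMeasurable
  have hleft : Tendsto (fun n => ∑ j, ∫ x, v x j * (β' (realTrigPoly (K n) (coeff f) x) *
      realTrigPoly (K n) (fun k => 2 * Real.pi * Complex.I * (k j : ℂ) * coeff f k) x)
        ∂(torusMeasure d)) atTop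
      (𝓝 (∑ j, ∫ x, v x j * (β' (f x) * g j x) ∂(torusMeasure d))) := by
    refine tendsto_finsetSum _ fun j _ => ?_
    refine tendsto_integral_mul_mul (hv j) (hg j).1 (fun n => hmem n j) ((hg j).2.1.comp hK)
      hm (fun n x => hC' _) ?_
    filter_upwards [hae] with x hx
    exact (hcβ'.tendsto _).comp hx
  have hright : Tendsto (fun n => - ∫ x, q x * β (realTrigPoly (K n) (coeff f) x) ∂(torusMeasure d))
      atTop (𝓝 (- ∫ x, q x * β (f x) ∂(torusMeasure d))) := by
    refine Tendsto.neg ?_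
    refine tendsto_integral_of_dominated_convergence (fun x => ‖q x‖ * C) (fun n => ?_)
      (hq.integrable_div.norm.mul_const C) (fun n => ?_) ?_
    · exact hq.integrable_div.1.mul (hcβ.comp (continuous_realTrigPoly _ _)).aestronglyMeasurable
    · filter_upwards with x
      rw [norm_mul]
      exact mul_le_mul_of_nonneg_left (hC _) (norm_nonneg _)
    · filter_upwards [hae] with x hx
      exact tendsto_const_nhds.mul ((hcβ.tendsto _).comp hx)
  refine tendsto_nhds_unique hleft (hright.congr fun n => ?_)
  rw [← hq.integral_eq _ (IsTestFunction.comp hβ (isTestFunction_realTrigPoly (K n) (coeff f))),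
    ← integral_finsetSum]
  · simp only [torusPartial_comp_realTrigPoly hβ']
  · intro j _
    refine (hv j).integrable_mul (q := 2) ?_
    refine (hmem n j).of_le_mul (c := C) ((hm n).mul (hmem n j).1)
      (Eventually.of_forall fun x => ?_)
    rw [norm_mul]
    exact mul_le_mul_of_nonneg_right (hC' _) (norm_nonneg _)

/-- `2 ∫ f v · ∇f ≤ ∫ (div v)_- f²`. As `div v` is only integrable and `f` may be unbounded, `f²` is
replaced by the bounded functions `f² / (1 + ε f²)`, which increase to `f²` as `ε → 0`. -/
lemma ofReal_integral_transport_le {v : UnitAddTorus (Fin d) → Fin d → ℝ}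
    {q f : UnitAddTorus (Fin d) → ℝ} {g : Fin d → UnitAddTorus (Fin d) → ℝ} (hq : HasWeakDiv v q)
    (hv : ∀ j, MemLp (fun x => v x j) 2 (torusMeasure d)) (hf : MemLp f 2 (torusMeasure d))
    (hvf : ∀ j, MemLp (fun x => v x j * f x) 2 (torusMeasure d)) (hg : IsL2Gradient f g) :
    ENNReal.ofReal (2 * ∑ j, ∫ x, g j x * (v x j * f x) ∂(torusMeasure d)) ≤
      ∫⁻ x, ‖max (-(q x)) 0‖ₑ * ‖f x ^ 2‖ₑ ∂(torusMeasure d) := by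
  set ε : ℕ → ℝ := fun n => 1 / ((n : ℝ) + 1) with hεdef
  have hε : ∀ n, 0 < ε n := fun n => by positivity
  have hε0 : Tendsto ε atTop (𝓝 0) := tendsto_one_div_add_atTop_nhds_zero_nat
  -- the bounded smooth truncations of `t ↦ t ^ 2`
  let β : ℕ → ℝ → ℝ := fun n t => t ^ 2 / (1 + ε n * t ^ 2)
  let β' : ℕ → ℝ → ℝ := fun n t => 2 * t / (1 + ε n * t ^ 2) ^ 2
  have hpos : ∀ n t, 1 ≤ 1 + ε n * t ^ 2 := fun n t => by
    have := hε n
    nlinarith [mul_nonneg this.le (sq_nonneg t)]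
  have hβs : ∀ n, ContDiff ℝ ∞ (β n) := fun n =>
    (contDiff_id.pow 2).div (contDiff_const.add (contDiff_const.mul (contDiff_id.pow 2)))
      fun t => (lt_of_lt_of_le one_pos (hpos n t)).ne'
  have hβd : ∀ n t, HasDerivAt (β n) (β' n t) t := fun n t => by
    have hne : 1 + ε n * t ^ 2 ≠ 0 := (lt_of_lt_of_le one_pos (hpos n t)).ne'
    have h1 : HasDerivAt (fun t : ℝ => t ^ 2) (2 * t) t := by simpa using hasDerivAt_pow 2 t
    refine (h1.div ((h1.const_mul (ε n)).const_add 1) hne).congr_deriv ?_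
    simp only [β']
    congr 1
    ring
  have hβ0 : ∀ n t, 0 ≤ β n t := fun n t =>
    div_nonneg (sq_nonneg t) (zero_le_one.trans (hpos n t))
  have hβle : ∀ n t, β n t ≤ t ^ 2 := fun n t => div_le_self (sq_nonneg t) (hpos n t)
  have hβ'le : ∀ n t, |β' n t| ≤ 2 * |t| / (1 + ε n * t ^ 2) := fun n t => by
    have h := hpos n t
    simp only [β', abs_div, abs_mul, abs_two, abs_pow]
    rw [abs_of_nonneg (zero_le_one.trans h)]
    exact div_le_div_of_nonneg_left (by positivity) (by linarith) (by nlinarith)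
  have hC : ∀ n t, |β n t| ≤ 1 + 1 / ε n := fun n t => by
    have h := hpos n t
    have := hε n
    rw [abs_of_nonneg (hβ0 n t), div_le_iff₀ (by linarith)]
    have h2 : (1 + 1 / ε n) * (1 + ε n * t ^ 2) = 1 + ε n * t ^ 2 + 1 / ε n + t ^ 2 := by
      field_simp
      ring
    have : 0 < 1 / ε n := by positivity
    nlinarith
  have hC' : ∀ n t, |β' n t| ≤ 1 + 1 / ε n := fun n t => by
    have h := hpos n t
    have := hε n
    refine (hβ'le n t).trans ?_
    rw [div_le_iff₀ (by linarith)]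
    have h2 : (1 + 1 / ε n) * (1 + ε n * t ^ 2) = 1 + ε n * t ^ 2 + 1 / ε n + t ^ 2 := by
      field_simp
      ring
    have : 0 < 1 / ε n := by positivity
    nlinarith [sq_abs t, sq_nonneg (|t| - 1)]
  have hβ'c : ∀ n, Continuous (β' n) := fun n =>
    (continuous_const.mul continuous_id).div (by fun_prop) fun t =>
      (pow_pos (lt_of_lt_of_le one_pos (hpos n t)) 2).ne'
  have hlim : Tendsto (fun n => ∑ j, ∫ x, v x j * (β' n (f x) * g j x) ∂(torusMeasure d)) atTop
      (𝓝 (2 * ∑ j, ∫ x, g j x * (v x j * f x) ∂(torusMeasure d))) := by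
    rw [Finset.mul_sum]
    refine tendsto_finsetSum _ fun j _ => ?_
    rw [← integral_const_mul]
    refine tendsto_integral_of_dominated_convergence (fun x => 2 * ‖g j x * (v x j * f x)‖)
      (fun n => ?_) (((hg j).1.integrable_mul (hvf j)).norm.const_mul 2) (fun n => ?_) ?_
    · exact (hv j).1.mul (((hβ'c n).comp_aestronglyMeasurable hf.1).mul (hg j).1.1)
    · filter_upwards with x
      have h : |β' n (f x)| ≤ 2 * |f x| :=
        (hβ'le n _).trans (div_le_self (by positivity) (hpos n _))
      simp only [norm_mul, Real.norm_eq_abs]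
      calc |v x j| * (|β' n (f x)| * |g j x|) ≤ |v x j| * (2 * |f x| * |g j x|) := by gcongr
        _ = 2 * (|g j x| * (|v x j| * |f x|)) := by ring
    · filter_upwards with x
      have : Tendsto (fun n => β' n (f x)) atTop (𝓝 (2 * f x / (1 + 0 * f x ^ 2) ^ 2)) :=
        tendsto_const_nhds.div ((tendsto_const_nhds.add (hε0.mul_const _)).pow 2) (by simp)
      have h2 := (tendsto_const_nhds (x := v x j)).mul (this.mul_const (g j x))
      convert h2 using 2
      simp
      ring
  refine le_of_tendsto ((ENNReal.continuous_ofReal.tendsto _).comp hlim)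
    (Eventually.of_forall fun n => ?_)
  simp only [Function.comp]
  rw [hq.integral_comp hv hf hg (hβs n) (hβd n) (hC n) (hC' n), ← integral_neg]
  have hqβ : ∀ {p : UnitAddTorus (Fin d) → ℝ}, Integrable p (torusMeasure d) →
      Integrable (fun x => p x * β n (f x)) (torusMeasure d) := fun hp =>
    hp.mul_bdd (c := 1 + 1 / ε n) ((hβs n).continuous.comp_aestronglyMeasurable hf.1)
      (Eventually.of_forall fun x => hC n _)
  have hneg : Integrable (fun x => max (-(q x)) 0) (torusMeasure d) := hq.integrable_div.neg_part
  calc ENNReal.ofReal (∫ x, -(q x * β n (f x)) ∂(torusMeasure d))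
      ≤ ENNReal.ofReal (∫ x, max (-(q x)) 0 * β n (f x) ∂(torusMeasure d)) := by
        refine ENNReal.ofReal_mono (integral_mono (hqβ hq.integrable_div).neg (hqβ hneg) fun x => ?_)
        simp only
        rw [← neg_mul]
        exact mul_le_mul_of_nonneg_right (le_max_left _ _) (hβ0 n _)
    _ = ∫⁻ x, ENNReal.ofReal (max (-(q x)) 0 * β n (f x)) ∂(torusMeasure d) :=
        ofReal_integral_eq_lintegral_ofReal (hqβ hneg)
          (Eventually.of_forall fun x => mul_nonneg (le_max_right _ _) (hβ0 n _))
    _ ≤ _ := by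
        refine lintegral_mono fun x => ?_
        rw [Real.enorm_of_nonneg (le_max_right _ _), Real.enorm_of_nonneg (sq_nonneg _),
          ← ENNReal.ofReal_mul (le_max_right _ _)]
        exact ENNReal.ofReal_mono (mul_le_mul_of_nonneg_left (hβle n _) (le_max_right _ _))

/-! ### The Sobolev inequality and absorption of the transport term -/

lemma coeff_const_mul (c : ℝ) (f : UnitAddTorus (Fin d) → ℝ) (k : Fin d → ℤ) :
    coeff (fun x => c * f x) k = c * coeff f k := by
  rw [coeff_eq_integral, coeff_eq_integral, ← integral_const_mul]
  refine integral_congr_ae (Eventually.of_forall fun x => ?_)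
  push_cast
  ring

lemma homSobolevSq_const_mul (h c : ℝ) (f : UnitAddTorus (Fin d) → ℝ) :
    homSobolevSq h (fun x => c * f x) = ENNReal.ofReal (c ^ 2) * homSobolevSq h f := by
  unfold homSobolevSq
  rw [← ENNReal.tsum_mul_left]
  refine tsum_congr fun k => ?_
  rw [← ENNReal.ofReal_mul (sq_nonneg c), coeff_const_mul, norm_mul, mul_pow, Complex.norm_real,
    Real.norm_eq_abs, sq_abs]
  congr 1
  ring

lemma coeff_zero (f : UnitAddTorus (Fin d) → ℝ) :
    coeff f 0 = ((∫ x, f x ∂(torusMeasure d) : ℝ) : ℂ) := by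
  rw [coeff_eq_integral, ← integral_complex_ofReal]
  simp [mFourier_zero]

lemma freq_zero : freq (0 : Fin d → ℤ) = 0 := by simp [freq]

lemma one_le_freq {k : Fin d → ℤ} (hk : k ≠ 0) : 1 ≤ freq k := by
  obtain ⟨j, hj⟩ := Function.ne_iff.1 hk
  have h1 : (1 : ℝ) ≤ (k j : ℝ) ^ 2 := by
    have : 1 ≤ |k j| := Int.one_le_abs hj
    rw [← sq_abs]
    exact one_le_pow₀ (by exact_mod_cast this)
  have h2 : (1 : ℝ) ≤ ∑ j, (k j : ℝ) ^ 2 :=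
    h1.trans (Finset.single_le_sum (f := fun j => (k j : ℝ) ^ 2) (fun i _ => sq_nonneg _)
      (Finset.mem_univ j))
  have h3 : 1 ≤ Real.sqrt (∑ j, (k j : ℝ) ^ 2) := Real.one_le_sqrt.2 h2
  unfold freq
  nlinarith [Real.pi_gt_three]

lemma ae_eq_zero_of_homSobolevSq_eq_zero {h : ℝ} {f : UnitAddTorus (Fin d) → ℝ}
    (hf : MemLp f 2 (torusMeasure d)) (hf0 : ∫ x, f x ∂(torusMeasure d) = 0)
    (hz : homSobolevSq h f = 0) : f =ᵐ[torusMeasure d] 0 := by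
  have hc : ∀ k, coeff f k = 0 := by
    intro k
    rcases eq_or_ne k 0 with rfl | hk
    · rw [coeff_zero, hf0, Complex.ofReal_zero]
    · have h1 := ENNReal.tsum_eq_zero.1 hz k
      have hpos : 0 < freq k ^ (2 * h) := Real.rpow_pos_of_pos (zero_lt_one.trans_le (one_le_freq hk)) _
      have h2 : freq k ^ (2 * h) * ‖coeff f k‖ ^ 2 ≤ 0 := ENNReal.ofReal_eq_zero.1 h1
      have h3 : ‖coeff f k‖ ^ 2 ≤ 0 := by
        by_contra hcon
        push Not at hcon
        exact absurd h2 (not_le.2 (mul_pos hpos hcon))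
      simpa using le_antisymm h3 (sq_nonneg _)
  have h4 := tsum_ofReal_sq_coeff hf
  simp only [hc, norm_zero, ne_eq, OfNat.ofNat_ne_zero, not_false_eq_true, zero_pow,
    ENNReal.ofReal_zero, tsum_zero] at h4
  exact (eLpNorm_eq_zero_iff hf.1 (by simp)).1 (pow_eq_zero_iff two_ne_zero |>.1 h4.symm)

/-- The Sobolev inequality with the constant `S_h`, without normalisation. -/
lemma sobolevConst_mul_eLpNorm_sq_le (h : ℝ) {f : UnitAddTorus (Fin d) → ℝ}
    (hf : MemLp f 2 (torusMeasure d)) (hf0 : ∫ x, f x ∂(torusMeasure d) = 0) :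
    sobolevConst d h * eLpNorm f (ENNReal.ofReal (2 * d / (d - 2 * h))) (torusMeasure d) ^ 2 ≤
      homSobolevSq h f := by
  set p := ENNReal.ofReal (2 * d / (d - 2 * h))
  rcases eq_or_ne (homSobolevSq h f) 0 with hz | hz
  · rw [eLpNorm_congr_ae (ae_eq_zero_of_homSobolevSq_eq_zero hf hf0 hz)]
    simp
  rcases eq_or_ne (homSobolevSq h f) ⊤ with ht | ht
  · rw [ht]; exact le_top
  set H := (homSobolevSq h f).toReal with hH
  have hHpos : 0 < H := ENNReal.toReal_pos hz ht
  have hHeq : homSobolevSq h f = ENNReal.ofReal H := (ENNReal.ofReal_toReal ht).symm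
  -- `c • f` is normalised in the homogeneous Sobolev norm
  set c : ℝ := (Real.sqrt H)⁻¹ with hc
  have hc2 : c ^ 2 = H⁻¹ := by rw [hc, inv_pow, Real.sq_sqrt hHpos.le]
  have h1 : homSobolevSq h (fun x => c * f x) = 1 := by
    rw [homSobolevSq_const_mul, hHeq, ← ENNReal.ofReal_mul (sq_nonneg c), hc2,
      inv_mul_cancel₀ hHpos.ne', ENNReal.ofReal_one]
  have h2 : eLpNorm (fun x => c * f x) p (torusMeasure d) ^ 2 ≤ (sobolevConst d h)⁻¹ := by
    rw [sobolevConst, inv_inv]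
    refine le_iSup_of_le (fun x => c * f x) (le_iSup_of_le (hf.const_mul c)
      (le_iSup_of_le ?_ (le_iSup_of_le h1 le_rfl)))
    rw [integral_const_mul, hf0, mul_zero]
  have h3 : eLpNorm (fun x => c * f x) p (torusMeasure d) ^ 2 =
      ENNReal.ofReal (H⁻¹) * eLpNorm f p (torusMeasure d) ^ 2 := by
    have : (fun x => c * f x) = c • f := rfl
    rw [this, eLpNorm_const_smul, mul_pow, ← hc2, Real.enorm_eq_ofReal_abs,
      ← ENNReal.ofReal_pow (abs_nonneg c), sq_abs]
  rw [h3] at h2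
  calc sobolevConst d h * eLpNorm f p (torusMeasure d) ^ 2
      = sobolevConst d h * (ENNReal.ofReal H⁻¹ * eLpNorm f p (torusMeasure d) ^ 2)
          * ENNReal.ofReal H := by
        have : ENNReal.ofReal H⁻¹ * ENNReal.ofReal H = 1 := by
          rw [← ENNReal.ofReal_mul (by positivity), inv_mul_cancel₀ hHpos.ne', ENNReal.ofReal_one]
        calc _ = sobolevConst d h * eLpNorm f p (torusMeasure d) ^ 2 *
              (ENNReal.ofReal H⁻¹ * ENNReal.ofReal H) := by rw [this, mul_one]
          _ = _ := by ring
    _ ≤ sobolevConst d h * (sobolevConst d h)⁻¹ * ENNReal.ofReal H := by gcongr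
    _ ≤ 1 * ENNReal.ofReal H := by gcongr; exact ENNReal.mul_inv_le_one _
    _ = homSobolevSq h f := by rw [one_mul, hHeq]

/-- Hölder's inequality for `q f²` with the conjugate exponents `n / a` and `n / (n - a)`. -/
lemma lintegral_mul_sq_le {X : Type*} [MeasurableSpace X] {μ : Measure X} {a n : ℝ} (ha : 0 < a)
    (han : a < n) {q f : X → ℝ} (hq : AEStronglyMeasurable q μ) (hf : AEStronglyMeasurable f μ) :
    ∫⁻ x, ‖q x‖ₑ * ‖f x ^ 2‖ₑ ∂μ ≤
      eLpNorm q (ENNReal.ofReal (n / a)) μ * eLpNorm f (ENNReal.ofReal (2 * n / (n - a))) μ ^ 2 := by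
  have hn : 0 < n := ha.trans han
  have hna : 0 < n - a := sub_pos.2 han
  have hpq : (n / a).HolderConjugate (n / (n - a)) := by
    rw [Real.holderConjugate_iff]
    refine ⟨(one_lt_div ha).2 han, ?_⟩
    rw [inv_div, inv_div]
    field_simp
    ring
  refine (ENNReal.lintegral_mul_le_Lp_mul_Lq μ hpq hq.enorm (hf.pow 2).enorm).trans (le_of_eq ?_)
  have hp0 : 0 < n / a := by positivity
  have hs0 : 0 < 2 * n / (n - a) := by positivity
  rw [eLpNorm_eq_lintegral_rpow_enorm_toReal (ENNReal.ofReal_pos.2 hp0).ne' ENNReal.ofReal_ne_top,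
    eLpNorm_eq_lintegral_rpow_enorm_toReal (ENNReal.ofReal_pos.2 hs0).ne' ENNReal.ofReal_ne_top,
    ENNReal.toReal_ofReal hp0.le, ENNReal.toReal_ofReal hs0.le]
  congr 1
  rw [← ENNReal.rpow_natCast, ← ENNReal.rpow_mul]
  congr 1
  · refine lintegral_congr fun x => ?_
    simp only [Pi.pow_apply, enorm_pow]
    rw [← ENNReal.rpow_natCast, ← ENNReal.rpow_mul]
    congr 1
    push_cast
    ring
  · push_cast
    field_simp

/-- Under the smallness assumption on `(div v)_-`, the transport term is absorbed by the
fractional dissipation. -/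
lemma ofReal_integral_transport_le_homSobolevSq {α : ℝ} (hα : 0 < α) (hd : α < d)
    {v : UnitAddTorus (Fin d) → Fin d → ℝ}
    {q f : UnitAddTorus (Fin d) → ℝ} {g : Fin d → UnitAddTorus (Fin d) → ℝ} (hq : HasWeakDiv v q)
    (hqS : eLpNorm (fun x => max (-(q x)) 0) (ENNReal.ofReal (d / α)) (torusMeasure d) ≤
      sobolevConst d (α / 2))
    (hv : ∀ j, MemLp (fun x => v x j) 2 (torusMeasure d)) (hf : MemLp f 2 (torusMeasure d))
    (hf0 : ∫ x, f x ∂(torusMeasure d) = 0)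
    (hvf : ∀ j, MemLp (fun x => v x j * f x) 2 (torusMeasure d)) (hg : IsL2Gradient f g) :
    ENNReal.ofReal (2 * ∑ j, ∫ x, g j x * (v x j * f x) ∂(torusMeasure d)) ≤
      homSobolevSq (α / 2) f := by
  have hS := sobolevConst_mul_eLpNorm_sq_le (α / 2) hf hf0
  rw [mul_div_cancel₀ α two_ne_zero] at hS
  refine (ofReal_integral_transport_le hq hv hf hvf hg).trans ?_
  refine (lintegral_mul_sq_le hα hd hq.integrable_div.neg_part.1 hf.1).trans ?_
  exact (mul_le_mul_left hqS _).trans hS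

/-! ### Chain rule in time and measurability of time slices -/

lemma sq_sub_sq_eq_intervalIntegral {x y : ℝ → ℝ} {r s : ℝ} (hrs : r ≤ s)
    (hy : IntervalIntegrable y volume r s)
    (h : ∀ t ∈ Set.Icc r s, x t - x r = ∫ τ in r..t, y τ) :
    x s ^ 2 - x r ^ 2 = ∫ τ in r..s, 2 * (x τ * y τ) := by
  set I : ℝ → ℝ := fun t => ∫ τ in r..t, y τ with hI
  have hac : AbsolutelyContinuousOnInterval I r s :=
    hy.absolutelyContinuousOnInterval_intervalIntegral (c := r) (by simp)
  have h1 := hac.integral_deriv_mul_eq_sub hac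
  have hIr : I r = 0 := by simp [hI]
  have hIs : I s = x s - x r := (h s (Set.right_mem_Icc.2 hrs)).symm
  have h2 : ∫ τ in r..s, (deriv I τ * I τ + I τ * deriv I τ) = ∫ τ in r..s, 2 * (I τ * y τ) := by
    refine intervalIntegral.integral_congr_ae ?_
    filter_upwards [hy.ae_hasDerivAt_integral] with τ hτ hmem
    have := (hτ (Set.uIoc_subset_uIcc hmem) r (by simp)).deriv
    rw [show deriv I τ = y τ from this]
    ring
  have h3 : ∫ τ in r..s, 2 * (x τ * y τ) = ∫ τ in r..s, (2 * (I τ * y τ) + 2 * x r * y τ) := by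
    refine intervalIntegral.integral_congr fun τ hτ => ?_
    rw [Set.uIcc_of_le hrs] at hτ
    have : I τ = x τ - x r := (h τ hτ).symm
    simp only [this]
    ring
  have hi : IntervalIntegrable (fun τ => 2 * (I τ * y τ)) volume r s :=
    (hy.continuousOn_mul hac.continuousOn).const_mul 2
  rw [h3, intervalIntegral.integral_add hi (hy.const_mul _), ← h2, h1,
    intervalIntegral.integral_const_mul, hIr, show ∫ τ in r..s, y τ = I s from rfl, hIs]
  ring

/-- The chain rule for `|a|²` when `a` is the primitive of an integrable function `b`. -/
lemma norm_sq_sub_norm_sq_eq_intervalIntegral {a b : ℝ → ℂ} {r s : ℝ} (hrs : r ≤ s)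
    (hb : IntervalIntegrable b volume r s)
    (h : ∀ t ∈ Set.Icc r s, a t - a r = ∫ τ in r..t, b τ) :
    ‖a s‖ ^ 2 - ‖a r‖ ^ 2 = ∫ τ in r..s, 2 * (conj (a τ) * b τ).re := by
  have hsub : ∀ t ∈ Set.Icc r s, IntervalIntegrable b volume r t := fun t ht =>
    hb.mono_set (by rw [Set.uIcc_of_le hrs, Set.uIcc_of_le ht.1]; exact Set.Icc_subset_Icc_right ht.2)
  have hre : IntervalIntegrable (fun τ => (b τ).re) volume r s := ⟨hb.1.re, hb.2.re⟩
  have him : IntervalIntegrable (fun τ => (b τ).im) volume r s := ⟨hb.1.im, hb.2.im⟩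
  have h1 := sq_sub_sq_eq_intervalIntegral (x := fun t => (a t).re) hrs hre fun t ht => by
    have := Complex.reCLM.intervalIntegral_comp_comm (hsub t ht)
    simp only [Complex.reCLM_apply] at this
    rw [this, ← h t ht, Complex.sub_re]
  have h2 := sq_sub_sq_eq_intervalIntegral (x := fun t => (a t).im) hrs him fun t ht => by
    have := Complex.imCLM.intervalIntegral_comp_comm (hsub t ht)
    simp only [Complex.imCLM_apply] at this
    rw [this, ← h t ht, Complex.sub_im]
  have hcont : ContinuousOn a (Set.uIcc r s) := by
    have := intervalIntegral.continuousOn_primitive_interval'  hb (Set.left_mem_uIcc)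
    refine (this.const_add (a r)).congr fun t ht => ?_
    rw [Set.uIcc_of_le hrs] at ht
    simp only [← h t ht]
    ring
  have hi1 : IntervalIntegrable (fun τ => 2 * ((a τ).re * (b τ).re)) volume r s :=
    (hre.continuousOn_mul (Complex.continuous_re.comp_continuousOn hcont)).const_mul 2
  have hi2 : IntervalIntegrable (fun τ => 2 * ((a τ).im * (b τ).im)) volume r s :=
    (him.continuousOn_mul (Complex.continuous_im.comp_continuousOn hcont)).const_mul 2
  have h3 : ∫ τ in r..s, 2 * (conj (a τ) * b τ).re =
      ∫ τ in r..s, (2 * ((a τ).re * (b τ).re) + 2 * ((a τ).im * (b τ).im)) := by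
    refine intervalIntegral.integral_congr fun τ _ => ?_
    simp only [Complex.mul_re, Complex.conj_re, Complex.conj_im]
    ring
  rw [h3, intervalIntegral.integral_add hi1 hi2, ← h1, ← h2, Complex.sq_norm, Complex.sq_norm,
    Complex.normSq_apply, Complex.normSq_apply]
  ring

lemma integrable_of_lintegral_enorm_sq {X E : Type*} [MeasurableSpace X] {μ : Measure X}
    [IsFiniteMeasure μ] [NormedAddCommGroup E] {f : X → E} (hf : AEStronglyMeasurable f μ)
    (h : ∫⁻ x, ‖f x‖ₑ ^ 2 ∂μ < ⊤) : Integrable f μ := by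
  refine MemLp.integrable (q := 2) (by norm_num) ⟨hf, ?_⟩
  rw [eLpNorm_lt_top_iff_lintegral_rpow_enorm_lt_top (by simp) (by simp)]
  simpa using h

lemma eLpNorm_two_sq_eq_lintegral {X E : Type*} [MeasurableSpace X] {μ : Measure X}
    [NormedAddCommGroup E] (f : X → E) : eLpNorm f 2 μ ^ 2 = ∫⁻ x, ‖f x‖ₑ ^ 2 ∂μ := by
  have := eLpNorm_nnreal_pow_eq_lintegral (f := f) (μ := μ) (p := 2) (by simp)
  simpa using this

lemma ofReal_sq_norm (z : ℂ) : ENNReal.ofReal (‖z‖ ^ 2) = ‖z‖ₑ ^ 2 := by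
  rw [ENNReal.ofReal_pow (norm_nonneg _), ofReal_norm]

lemma aestronglyMeasurable_coeff {ν : Measure ℝ} {u : ℝ → UnitAddTorus (Fin d) → ℝ}
    (hu : AEStronglyMeasurable (fun p : ℝ × UnitAddTorus (Fin d) => u p.1 p.2)
      (ν.prod (torusMeasure d)))
    (k : Fin d → ℤ) :
    AEStronglyMeasurable (fun τ => coeff (u τ) k) ν := by
  simp only [coeff_eq_integral]
  refine AEStronglyMeasurable.integral_prod_right'
    (f := fun p : ℝ × UnitAddTorus (Fin d) => mFourier (-k) p.2 * (u p.1 p.2 : ℂ)) ?_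
  refine AEStronglyMeasurable.mul ?_ (Complex.continuous_ofReal.comp_aestronglyMeasurable hu)
  exact ((mFourier (-k)).continuous.comp continuous_snd).aestronglyMeasurable

lemma aemeasurable_homSobolevSq {ν : Measure ℝ} {u : ℝ → UnitAddTorus (Fin d) → ℝ}
    (hu : AEStronglyMeasurable (fun p : ℝ × UnitAddTorus (Fin d) => u p.1 p.2)
      (ν.prod (torusMeasure d)))
    (h : ℝ) : AEMeasurable (fun τ => homSobolevSq h (u τ)) ν := by
  unfold homSobolevSq
  refine AEMeasurable.tsum fun k => ?_
  exact (((aestronglyMeasurable_coeff hu k).norm.aemeasurable.pow_const 2).const_mul _).ennreal_ofReal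

lemma aemeasurable_eLpNorm_two_sq {ν : Measure ℝ} {u : ℝ → UnitAddTorus (Fin d) → ℝ}
    (hu : AEStronglyMeasurable (fun p : ℝ × UnitAddTorus (Fin d) => u p.1 p.2)
      (ν.prod (torusMeasure d))) :
    AEMeasurable (fun τ => eLpNorm (u τ) 2 (torusMeasure d) ^ 2) ν := by
  simp only [eLpNorm_two_sq_eq_lintegral]
  exact (hu.enorm.pow_const 2).lintegral_prod_right'

/-! ### The energy inequality between positive times -/

/-- The `k`-th Fourier coefficient of `-(-Δ)^{α/2} f - div F`. -/
def evolutionCoeff (α : ℝ) (f : UnitAddTorus (Fin d) → ℝ)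
    (F : Fin d → UnitAddTorus (Fin d) → ℝ) (k : Fin d → ℤ) : ℂ :=
  - ((freq k ^ α : ℝ) : ℂ) * coeff f k - ∑ j, 2 * Real.pi * Complex.I * (k j : ℂ) * coeff (F j) k

/-- The contribution of one Fourier mode to the time derivative of the energy. -/
lemma re_conj_mul_evolutionCoeff (α : ℝ) (f : UnitAddTorus (Fin d) → ℝ)
    (F : Fin d → UnitAddTorus (Fin d) → ℝ) (k : Fin d → ℤ) :
    2 * (conj (coeff f k) * evolutionCoeff α f F k).re =
      -2 * (freq k ^ α * ‖coeff f k‖ ^ 2) +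
        2 * ∑ j, (conj (2 * Real.pi * Complex.I * (k j : ℂ) * coeff f k) * coeff (F j) k).re := by
  have h1 : conj (coeff f k) * evolutionCoeff α f F k =
      ((-(freq k ^ α * ‖coeff f k‖ ^ 2) : ℝ) : ℂ) +
        ∑ j, conj (2 * Real.pi * Complex.I * (k j : ℂ) * coeff f k) * coeff (F j) k := by
    have h2 : conj (coeff f k) * coeff f k = ((‖coeff f k‖ ^ 2 : ℝ) : ℂ) := by
      rw [Complex.conj_mul']
      push_cast
      ring
    have h3 : ∑ j, conj (2 * Real.pi * Complex.I * (k j : ℂ) * coeff f k) * coeff (F j) k =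
        - (conj (coeff f k) * ∑ j, 2 * Real.pi * Complex.I * (k j : ℂ) * coeff (F j) k) := by
      rw [Finset.mul_sum, ← Finset.sum_neg_distrib]
      refine Finset.sum_congr rfl fun j _ => ?_
      simp only [map_mul, Complex.conj_I, Complex.conj_ofReal, map_ofNat, map_intCast]
      ring
    rw [h3, evolutionCoeff, mul_sub]
    have h4 : conj (coeff f k) * (-((freq k ^ α : ℝ) : ℂ) * coeff f k) =
        -((freq k ^ α : ℝ) : ℂ) * (conj (coeff f k) * coeff f k) := by ring
    rw [h4, h2]
    push_cast
    ring
  rw [h1, Complex.add_re, Complex.ofReal_re, Complex.re_sum]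
  ring

/-- Since nonzero frequencies are at least one, the fractional symbol is dominated by `|ξ|²`. -/
lemma freq_rpow_le {α : ℝ} (hα : 0 < α) (hα2 : α ≤ 2) (k : Fin d → ℤ) :
    freq k ^ α ≤ freq k ^ (2 : ℝ) := by
  rcases eq_or_ne k 0 with rfl | hk
  · rw [freq_zero, Real.zero_rpow hα.ne', Real.zero_rpow two_ne_zero]
  · exact Real.rpow_le_rpow_of_exponent_le (one_le_freq hk) hα2

lemma homSobolevSq_le_one {α : ℝ} (hα : 0 < α) (hα2 : α ≤ 2) (f : UnitAddTorus (Fin d) → ℝ) :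
    homSobolevSq (α / 2) f ≤ homSobolevSq 1 f := by
  refine ENNReal.tsum_le_tsum fun k => ENNReal.ofReal_mono ?_
  rw [mul_div_cancel₀ α two_ne_zero, mul_one]
  exact mul_le_mul_of_nonneg_right (freq_rpow_le hα hα2 k) (sq_nonneg _)

lemma abs_re_conj_mul_evolutionCoeff_le {α : ℝ} (hα : 0 < α) (hα2 : α ≤ 2)
    (f : UnitAddTorus (Fin d) → ℝ) (F : Fin d → UnitAddTorus (Fin d) → ℝ) (k : Fin d → ℤ) :
    |2 * (conj (coeff f k) * evolutionCoeff α f F k).re| ≤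
      3 * (freq k ^ ((2 : ℝ) * 1) * ‖coeff f k‖ ^ 2) + ∑ j, ‖coeff (F j) k‖ ^ 2 := by
  have h0 := freq_nonneg k
  rw [re_conj_mul_evolutionCoeff, mul_one]
  have h1 : ∀ j, |(conj (2 * Real.pi * Complex.I * (k j : ℂ) * coeff f k) * coeff (F j) k).re| * 2 ≤
      (2 * Real.pi * (k j : ℝ)) ^ 2 * ‖coeff f k‖ ^ 2 + ‖coeff (F j) k‖ ^ 2 := by
    intro j
    refine (mul_le_mul_of_nonneg_right (Complex.abs_re_le_norm _) zero_le_two).trans ?_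
    rw [norm_mul, RCLike.norm_conj, ← norm_symbol_mul_sq]
    nlinarith [sq_nonneg (‖2 * Real.pi * Complex.I * (k j : ℂ) * coeff f k‖ - ‖coeff (F j) k‖)]
  have h2 : |2 * ∑ j, (conj (2 * Real.pi * Complex.I * (k j : ℂ) * coeff f k) * coeff (F j) k).re| ≤
      freq k ^ (2 : ℝ) * ‖coeff f k‖ ^ 2 + ∑ j, ‖coeff (F j) k‖ ^ 2 := by
    rw [Real.rpow_two, sq_freq, Finset.sum_mul, ← Finset.sum_add_distrib, abs_mul, abs_two, mul_comm]
    refine (mul_le_mul_of_nonneg_right (Finset.abs_sum_le_sum_abs _ _) zero_le_two).trans ?_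
    rw [Finset.sum_mul]
    exact Finset.sum_le_sum fun j _ => h1 j
  have h3 : |-2 * (freq k ^ α * ‖coeff f k‖ ^ 2)| ≤ 2 * (freq k ^ (2 : ℝ) * ‖coeff f k‖ ^ 2) := by
    rw [abs_mul, abs_neg, abs_two, abs_of_nonneg (by positivity)]
    exact mul_le_mul_of_nonneg_left
      (mul_le_mul_of_nonneg_right (freq_rpow_le hα hα2 k) (sq_nonneg _)) zero_le_two
  linarith [abs_add_le (-2 * (freq k ^ α * ‖coeff f k‖ ^ 2))
    (2 * ∑ j, (conj (2 * Real.pi * Complex.I * (k j : ℂ) * coeff f k) * coeff (F j) k).re)]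

lemma tsum_enorm_re_conj_mul_evolutionCoeff_le {α : ℝ} (hα : 0 < α) (hα2 : α ≤ 2)
    (f : UnitAddTorus (Fin d) → ℝ) {F : Fin d → UnitAddTorus (Fin d) → ℝ}
    (hF : ∀ j, MemLp (F j) 2 (torusMeasure d)) :
    ∑' k, ‖2 * (conj (coeff f k) * evolutionCoeff α f F k).re‖ₑ ≤
      3 * homSobolevSq 1 f + ∑ j, eLpNorm (F j) 2 (torusMeasure d) ^ 2 := by
  calc ∑' k, ‖2 * (conj (coeff f k) * evolutionCoeff α f F k).re‖ₑ
      ≤ ∑' k, (3 * ENNReal.ofReal (freq k ^ ((2 : ℝ) * 1) * ‖coeff f k‖ ^ 2) +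
          ∑ j, ENNReal.ofReal (‖coeff (F j) k‖ ^ 2)) := by
        refine ENNReal.tsum_le_tsum fun k => ?_
        have h0 := freq_nonneg k
        rw [Real.enorm_eq_ofReal_abs]
        refine (ENNReal.ofReal_mono (abs_re_conj_mul_evolutionCoeff_le hα hα2 f F k)).trans ?_
        rw [ENNReal.ofReal_add (by positivity) (by positivity),
          ENNReal.ofReal_mul (by norm_num), ENNReal.ofReal_sum_of_nonneg fun _ _ => by positivity]
        simp
    _ = _ := by
        rw [ENNReal.tsum_add, ENNReal.tsum_mul_left, homSobolevSq,
          Summable.tsum_finsetSum fun _ _ => ENNReal.summable]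
        simp only [tsum_ofReal_sq_coeff (hF _)]

/-- The energy balance at a fixed time: half of the dissipation absorbs the transport term. -/
lemma tsum_re_conj_mul_evolutionCoeff_le {α : ℝ} (hα : 0 < α) (hα2 : α ≤ 2) (hd : α < d)
    {v : UnitAddTorus (Fin d) → Fin d → ℝ}
    {q f : UnitAddTorus (Fin d) → ℝ} (hq : HasWeakDiv v q)
    (hqS : eLpNorm (fun x => max (-(q x)) 0) (ENNReal.ofReal (d / α)) (torusMeasure d) ≤
      sobolevConst d (α / 2))
    (hv : ∀ j, MemLp (fun x => v x j) 2 (torusMeasure d)) (hf : MemLp f 2 (torusMeasure d))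
    (hf0 : ∫ x, f x ∂(torusMeasure d) = 0) (hf1 : homSobolevSq 1 f < ⊤)
    (hvf : ∀ j, MemLp (fun x => v x j * f x) 2 (torusMeasure d)) :
    ∑' k, 2 * (conj (coeff f k) * evolutionCoeff α f (fun j x => v x j * f x) k).re ≤
      - (homSobolevSq (α / 2) f).toReal := by
  obtain ⟨g, hg⟩ := exists_isL2Gradient hf1
  have hfin : homSobolevSq (α / 2) f < ⊤ := (homSobolevSq_le_one hα hα2 f).trans_lt hf1
  have hs := summable_of_homSobolevSq_lt_top hfin
  have hD : (homSobolevSq (α / 2) f).toReal = ∑' k, freq k ^ α * ‖coeff f k‖ ^ 2 := by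
    have hnn : ∀ k : Fin d → ℤ, 0 ≤ freq k ^ (2 * (α / 2)) * ‖coeff f k‖ ^ 2 := fun k => by
      have := freq_nonneg k
      positivity
    rw [homSobolevSq, ← ENNReal.ofReal_tsum_of_nonneg hnn hs, ENNReal.toReal_ofReal (tsum_nonneg hnn),
      mul_div_cancel₀ α two_ne_zero]
  rw [mul_div_cancel₀ α two_ne_zero] at hs
  have hP := (hasSum_sum (s := Finset.univ) fun j _ => (hg j).2.2 _ (hvf j)).mul_left 2
  have hsum := (hs.hasSum.mul_left (-2)).add hP
  have htr := ofReal_integral_transport_le_homSobolevSq hα hd hq hqS hv hf hf0 hvf hg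
  rw [ENNReal.ofReal_le_iff_le_toReal hfin.ne] at htr
  simp only [re_conj_mul_evolutionCoeff]
  rw [hsum.tsum_eq, ← hD]
  linarith

section Energy

variable {α T : ℝ} {v : ℝ → UnitAddTorus (Fin d) → Fin d → ℝ}
  {divv : ℝ → UnitAddTorus (Fin d) → ℝ} {ψ₀ : UnitAddTorus (Fin d) → ℝ}
  {ψ : ℝ → UnitAddTorus (Fin d) → ℝ}

lemma IsSolution.aestronglyMeasurable_flux (hψ : IsSolution α T v ψ₀ ψ)
    (hv : IsAdvectionField T v divv) (j : Fin d) :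
    AEStronglyMeasurable (fun p : ℝ × UnitAddTorus (Fin d) => v p.1 p.2 j * ψ p.1 p.2)
      ((volume.restrict (Set.Ioc 0 T)).prod (torusMeasure d)) :=
  (hv.measurable_field j).mul hψ.measurable

lemma restrict_Ioc_le {r s : ℝ} (hr : 0 < r) (hsT : s ≤ T) :
    (volume.restrict (Set.Ioc r s) : Measure ℝ) ≤ volume.restrict (Set.Ioc 0 T) :=
  Measure.restrict_mono (Set.Ioc_subset_Ioc hr.le hsT) le_rfl

lemma IsSolution.lintegral_homSobolevSq_lt_top (hψ : IsSolution α T v ψ₀ ψ) {r s : ℝ}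
    (hr : 0 < r) (hsT : s ≤ T) : ∫⁻ τ in Set.Ioc r s, homSobolevSq 1 (ψ τ) < ⊤ :=
  (lintegral_mono_set (Set.Ioc_subset_Ioc_right hsT)).trans_lt (hψ.gradient r hr)

lemma IsSolution.lintegral_flux_lt_top (hψ : IsSolution α T v ψ₀ ψ) {r s : ℝ}
    (hr : 0 < r) (hsT : s ≤ T) (j : Fin d) :
    ∫⁻ τ in Set.Ioc r s, eLpNorm (fun x => v τ x j * ψ τ x) 2 (torusMeasure d) ^ 2 < ⊤ :=
  (lintegral_mono_set (Set.Ioc_subset_Ioc_right hsT)).trans_lt (hψ.flux r hr j)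

lemma IsSolution.ae_memLp_flux (hψ : IsSolution α T v ψ₀ ψ) (hv : IsAdvectionField T v divv)
    {r s : ℝ} (hr : 0 < r) (hsT : s ≤ T) :
    ∀ᵐ τ ∂(volume.restrict (Set.Ioc r s)), ∀ j,
      MemLp (fun x => v τ x j * ψ τ x) 2 (torusMeasure d) := by
  refine ae_all_iff.2 fun j => ?_
  have hm := hψ.aestronglyMeasurable_flux hv j
  have h1 := ae_lt_top' ((aemeasurable_eLpNorm_two_sq
    (u := fun τ x => v τ x j * ψ τ x) hm).mono_measure (restrict_Ioc_le hr hsT))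
    (hψ.lintegral_flux_lt_top hr hsT j).ne
  filter_upwards [h1, ae_mono (restrict_Ioc_le hr hsT) hm.prodMk_left] with τ h2 h3
  exact ⟨h3, (ENNReal.pow_lt_top_iff.1 h2).resolve_right two_ne_zero⟩

/-- Integrability in time of the right-hand side of the equation for one Fourier mode. The zero
mode needs no bound, since its symbol vanishes. -/
lemma IsSolution.integrable_evolutionCoeff (hψ : IsSolution α T v ψ₀ ψ)
    (hv : IsAdvectionField T v divv) (hα : 0 < α) {r s : ℝ} (hr : 0 < r) (hsT : s ≤ T)
    (k : Fin d → ℤ) :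
    Integrable (fun τ => evolutionCoeff α (ψ τ) (fun j x => v τ x j * ψ τ x) k)
      (volume.restrict (Set.Ioc r s)) := by
  have hle := restrict_Ioc_le (T := T) hr hsT
  refine Integrable.sub ?_ (integrable_finsetSum _ fun j _ => Integrable.const_mul ?_ _)
  · rcases eq_or_ne k 0 with rfl | hk
    · simp [freq_zero, Real.zero_rpow hα.ne']
    refine Integrable.const_mul ?_ _
    refine integrable_of_lintegral_enorm_sq
      ((aestronglyMeasurable_coeff hψ.measurable k).mono_measure hle) ?_
    refine (lintegral_mono fun τ => ?_).trans_lt (hψ.lintegral_homSobolevSq_lt_top hr hsT)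
    rw [← ofReal_sq_norm]
    refine le_trans (ENNReal.ofReal_mono ?_) (ENNReal.le_tsum k)
    rw [mul_one, Real.rpow_two]
    exact le_mul_of_one_le_left (sq_nonneg _) (one_le_pow₀ (one_le_freq hk))
  · refine integrable_of_lintegral_enorm_sq
      ((aestronglyMeasurable_coeff (u := fun τ x => v τ x j * ψ τ x)
        (hψ.aestronglyMeasurable_flux hv j) k).mono_measure hle) ?_
    refine (lintegral_mono_ae ?_).trans_lt (hψ.lintegral_flux_lt_top hr hsT j)
    filter_upwards [hψ.ae_memLp_flux hv hr hsT] with τ hτ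
    rw [← ofReal_sq_norm, ← tsum_ofReal_sq_coeff (hτ j)]
    exact ENNReal.le_tsum k

/-- The energy inequality between positive times, where the solution is in `H¹`: the chain rule for
each `|ψ̂(k)|²` is summed over `k`, the series being absolutely convergent in `L¹(r, s)`. -/
lemma IsSolution.energy_le (hα : 0 < α) (hα2 : α ≤ 2) (hd : α < d)
    (hψ : IsSolution α T v ψ₀ ψ) (hv : IsAdvectionField T v divv)
    (hdiv : essSup (fun τ => eLpNorm (fun x => max (-(divv τ x)) 0)
        (ENNReal.ofReal (d / α)) (torusMeasure d)) (volume.restrict (Set.Ioc 0 T))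
      ≤ sobolevConst d (α / 2))
    (havg : ∀ s ∈ Set.Icc 0 T, ∫ x, ψ s x ∂(torusMeasure d) = 0)
    {r s : ℝ} (hr : 0 < r) (hrs : r ≤ s) (hsT : s ≤ T) :
    eLpNorm (ψ s) 2 (torusMeasure d) ^ 2 + ∫⁻ τ in Set.Ioc r s, homSobolevSq (α / 2) (ψ τ) ≤
      eLpNorm (ψ r) 2 (torusMeasure d) ^ 2 := by
  set ν : Measure ℝ := volume.restrict (Set.Ioc r s) with hν
  have hle : ν ≤ volume.restrict (Set.Ioc 0 T) := restrict_Ioc_le hr hsT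
  set B : (Fin d → ℤ) → ℝ → ℂ := fun k τ => evolutionCoeff α (ψ τ) (fun j x => v τ x j * ψ τ x) k
    with hB
  set Φ : (Fin d → ℤ) → ℝ → ℝ := fun k τ => 2 * (conj (coeff (ψ τ) k) * B k τ).re with hΦ
  have hr_mem : r ∈ Set.Icc 0 T := ⟨hr.le, hrs.trans hsT⟩
  have hs_mem : s ∈ Set.Icc 0 T := ⟨hr.le.trans hrs, hsT⟩
  have hBi : ∀ k, Integrable (B k) ν := fun k => hψ.integrable_evolutionCoeff hv hα hr hsT k
  have hΦm : ∀ k, AEStronglyMeasurable (Φ k) ν := fun k => by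
    have h1 := (aestronglyMeasurable_coeff hψ.measurable k).mono_measure hle
    exact ((Complex.continuous_re.comp_aestronglyMeasurable
      ((Complex.continuous_conj.comp_aestronglyMeasurable h1).mul (hBi k).1)).const_mul 2)
  -- the energy balance of a single mode
  have hmode : ∀ k, ∫ τ, Φ k τ ∂ν = ‖coeff (ψ s) k‖ ^ 2 - ‖coeff (ψ r) k‖ ^ 2 := fun k => by
    rw [norm_sq_sub_norm_sq_eq_intervalIntegral (a := fun τ => coeff (ψ τ) k) (b := B k) hrs
      ((intervalIntegrable_iff_integrableOn_Ioc_of_le hrs).2 (hBi k))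
      fun t ht => hψ.equation r t hr ht.1 (ht.2.trans hsT) k, intervalIntegral.integral_of_le hrs]
  have h1fin : ∀ᵐ τ ∂ν, homSobolevSq 1 (ψ τ) < ⊤ :=
    ae_lt_top' ((aemeasurable_homSobolevSq hψ.measurable 1).mono_measure hle)
      (hψ.lintegral_homSobolevSq_lt_top hr hsT).ne
  -- absolute convergence, which allows summing the modes under the time integral
  have hbound : ∫⁻ τ, ∑' k, ‖Φ k τ‖ₑ ∂ν < ⊤ := by
    refine lt_of_le_of_lt (lintegral_mono_ae (g := fun τ => 3 * homSobolevSq 1 (ψ τ) +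
      ∑ j, eLpNorm (fun x => v τ x j * ψ τ x) 2 (torusMeasure d) ^ 2) ?_) ?_
    · filter_upwards [hψ.ae_memLp_flux hv hr hsT] with τ hτ
      exact tsum_enorm_re_conj_mul_evolutionCoeff_le hα hα2 (ψ τ) hτ
    · have hm1 := (aemeasurable_homSobolevSq hψ.measurable 1).mono_measure hle
      rw [lintegral_add_left' (hm1.const_mul 3), lintegral_const_mul'' _ hm1,
        lintegral_finsetSum' _ fun j _ => (aemeasurable_eLpNorm_two_sq
          (u := fun τ x => v τ x j * ψ τ x) (hψ.aestronglyMeasurable_flux hv j)).mono_measure hle]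
      refine ENNReal.add_lt_top.2 ⟨ENNReal.mul_lt_top (by simp)
        (hψ.lintegral_homSobolevSq_lt_top hr hsT), ENNReal.sum_lt_top.2 fun j _ =>
          hψ.lintegral_flux_lt_top hr hsT j⟩
  have htsum : ∫ τ, ∑' k, Φ k τ ∂ν =
      ∫ x, ψ s x ^ 2 ∂(torusMeasure d) - ∫ x, ψ r x ^ 2 ∂(torusMeasure d) := by
    rw [integral_tsum hΦm]
    · simp only [hmode]
      exact ((hasSum_sq_coeff (hψ.memLp s hs_mem)).sub
        (hasSum_sq_coeff (hψ.memLp r hr_mem))).tsum_eq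
    · rw [← lintegral_tsum fun k => (hΦm k).enorm]
      exact hbound.ne
  have hΦsum : ∀ᵐ τ ∂ν, Summable fun k => Φ k τ := by
    filter_upwards [ae_lt_top' (AEMeasurable.tsum fun k => (hΦm k).enorm) hbound.ne] with τ hτ
    exact Summable.of_enorm hτ.ne
  have hΦi : Integrable (fun τ => ∑' k, Φ k τ) ν := by
    refine ⟨aestronglyMeasurable_of_tendsto_ae atTop
      (f := fun (K : Finset (Fin d → ℤ)) τ => ∑ k ∈ K, Φ k τ)
      (fun K => Finset.aestronglyMeasurable_fun_sum _ fun k _ => hΦm k) ?_, ?_⟩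
    · filter_upwards [hΦsum] with τ hτ using hτ.hasSum
    · exact (lintegral_mono fun τ => enorm_tsum_le_tsum_enorm).trans_lt hbound
  have hDm : AEMeasurable (fun τ => homSobolevSq (α / 2) (ψ τ)) ν :=
    (aemeasurable_homSobolevSq hψ.measurable (α / 2)).mono_measure hle
  have hDfin : ∫⁻ τ, homSobolevSq (α / 2) (ψ τ) ∂ν < ⊤ :=
    (lintegral_mono fun τ => homSobolevSq_le_one hα hα2 (ψ τ)).trans_lt
      (hψ.lintegral_homSobolevSq_lt_top hr hsT)
  have hkey : ∫ τ, ∑' k, Φ k τ ∂ν ≤ ∫ τ, -(homSobolevSq (α / 2) (ψ τ)).toReal ∂ν := by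
    refine integral_mono_ae hΦi (integrable_toReal_of_lintegral_ne_top hDm hDfin.ne).neg ?_
    have hess := ae_le_essSup (μ := volume.restrict (Set.Ioc 0 T))
      (f := fun τ => eLpNorm (fun x => max (-(divv τ x)) 0)
        (ENNReal.ofReal (d / α)) (torusMeasure d))
    filter_upwards [h1fin, hψ.ae_memLp_flux hv hr hsT, ae_mono hle hv.memLp_field,
      ae_mono hle hv.hasWeakDiv, ae_mono hle hess, ae_restrict_mem measurableSet_Ioc]
      with τ h1 h2 h3 h4 h5 h6
    have hτ : τ ∈ Set.Icc 0 T := ⟨hr.le.trans h6.1.le, h6.2.trans hsT⟩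
    exact tsum_re_conj_mul_evolutionCoeff_le hα hα2 hd h4 (h5.trans hdiv) h3 (hψ.memLp τ hτ)
      (havg τ hτ) h1 h2
  rw [htsum, integral_neg, integral_toReal hDm (ae_lt_top' hDm hDfin.ne)] at hkey
  rw [eLpNorm_two_sq (hψ.memLp s hs_mem), eLpNorm_two_sq (hψ.memLp r hr_mem),
    ← ENNReal.ofReal_toReal hDfin.ne, ← ENNReal.ofReal_add
      (integral_nonneg fun x => sq_nonneg _) ENNReal.toReal_nonneg]
  exact ENNReal.ofReal_mono (by linarith)

end Energy

end

end PeriodicTransportDiffusion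

/-! ### The energy inequality from time zero -/

open PeriodicTransportDiffusion in
/-- Energy estimate for average-free solutions of the transport-diffusion equation on the torus. -/
theorem proposition3p4 (d : ℕ) (α : ℝ) (hα : 0 < α) (hα2 : α ≤ 2) (hd : α < d) (T : ℝ)
    (v : ℝ → UnitAddTorus (Fin d) → Fin d → ℝ) (divv : ℝ → UnitAddTorus (Fin d) → ℝ)
    (hv : IsAdvectionField T v divv)
    (hdiv : essSup (fun τ => eLpNorm (fun x => max (-(divv τ x)) 0)
        (ENNReal.ofReal (d / α)) (torusMeasure d)) (volume.restrict (Set.Ioc 0 T))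
      ≤ sobolevConst d (α / 2))
    (ψ₀ : UnitAddTorus (Fin d) → ℝ) (ψ : ℝ → UnitAddTorus (Fin d) → ℝ)
    (hψ : IsSolution α T v ψ₀ ψ)
    (havg : ∀ s ∈ Set.Icc 0 T, ∫ x, ψ s x ∂(torusMeasure d) = 0) :
    ∀ s ∈ Set.Icc 0 T,
      eLpNorm (ψ s) 2 (torusMeasure d) ^ 2
        + sobolevConst d (α / 2) * ∫⁻ τ in Set.Ioc 0 s,
            eLpNorm (ψ τ) (ENNReal.ofReal (2 * d / (d - α))) (torusMeasure d) ^ 2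
      ≤ eLpNorm ψ₀ 2 (torusMeasure d) ^ 2 := by
  intro s hs
  rw [← eLpNorm_congr_ae hψ.initial]
  have h0 : (0 : ℝ) ∈ Set.Icc 0 T := ⟨le_rfl, hs.1.trans hs.2⟩
  have hsob : sobolevConst d (α / 2) * ∫⁻ τ in Set.Ioc 0 s,
        eLpNorm (ψ τ) (ENNReal.ofReal (2 * d / (d - α))) (torusMeasure d) ^ 2 ≤
      ∫⁻ τ in Set.Ioc 0 s, homSobolevSq (α / 2) (ψ τ) := by
    refine (lintegral_const_mul_le _ _).trans (setLIntegral_mono' measurableSet_Ioc fun τ hτ => ?_)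
    have hτT : τ ∈ Set.Icc 0 T := ⟨hτ.1.le, hτ.2.trans hs.2⟩
    have := sobolevConst_mul_eLpNorm_sq_le (α / 2) (hψ.memLp τ hτT) (havg τ hτT)
    rwa [mul_div_cancel₀ α two_ne_zero] at this
  rcases eq_or_lt_of_le hs.1 with rfl | hs0
  · refine (add_le_add_right hsob _).trans ?_
    simp
  refine (add_le_add_right hsob _).trans ?_
  -- the energy at small times is controlled by the energy at time zero
  have hlim : Tendsto (fun r => (eLpNorm (ψ r - ψ 0) 2 (torusMeasure d) +
      eLpNorm (ψ 0) 2 (torusMeasure d)) ^ 2) (𝓝[Set.Ioc 0 s] 0)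
      (𝓝 (eLpNorm (ψ 0) 2 (torusMeasure d) ^ 2)) := by
    have h1 := (hψ.continuous 0 h0).mono_left (nhdsWithin_mono 0
      (show Set.Ioc 0 s ⊆ Set.Icc 0 T from fun r hr => ⟨hr.1.le, hr.2.trans hs.2⟩))
    have h2 := (h1.add_const (eLpNorm (ψ 0) 2 (torusMeasure d)))
    rw [zero_add] at h2
    exact ((ENNReal.continuous_pow 2).tendsto _).comp h2
  have hbot : (𝓝[Set.Ioc 0 s] (0 : ℝ)).NeBot := by
    rw [nhdsWithin_Ioc_eq_nhdsGT hs0]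
    infer_instance
  have hstep : ∀ r₀ ∈ Set.Ioc 0 s, eLpNorm (ψ s) 2 (torusMeasure d) ^ 2 +
      ∫⁻ τ in Set.Ioc r₀ s, homSobolevSq (α / 2) (ψ τ) ≤ eLpNorm (ψ 0) 2 (torusMeasure d) ^ 2 := by
    intro r₀ hr₀
    refine ge_of_tendsto hlim ?_
    filter_upwards [self_mem_nhdsWithin, mem_nhdsWithin_of_mem_nhds (Iio_mem_nhds hr₀.1)]
      with r hr hrr₀
    have hrT : r ∈ Set.Icc 0 T := ⟨hr.1.le, hr.2.trans hs.2⟩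
    calc _ ≤ eLpNorm (ψ s) 2 (torusMeasure d) ^ 2 +
          ∫⁻ τ in Set.Ioc r s, homSobolevSq (α / 2) (ψ τ) :=
          add_le_add_right (lintegral_mono_set (Set.Ioc_subset_Ioc_left (le_of_lt hrr₀))) _
      _ ≤ eLpNorm (ψ r) 2 (torusMeasure d) ^ 2 :=
          hψ.energy_le hα hα2 hd hv hdiv havg hr.1 hr.2 hs.2
      _ ≤ _ := by
          gcongr
          have := eLpNorm_add_le (p := 2) ((hψ.memLp r hrT).1.sub (hψ.memLp 0 h0).1)
            (hψ.memLp 0 h0).1 one_le_two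
          rwa [sub_add_cancel] at this
  -- `(0, s]` is exhausted by intervals on which the energy inequality is known
  have hU : Set.Ioc 0 s = ⋃ n : ℕ, Set.Ioc (s / ((n : ℝ) + 1)) s := by
    ext τ
    simp only [Set.mem_Ioc, Set.mem_iUnion]
    refine ⟨fun h => ?_, fun ⟨n, h⟩ => ⟨lt_trans (by positivity) h.1, h.2⟩⟩
    obtain ⟨n, hn⟩ := exists_nat_gt (s / τ)
    refine ⟨n, ?_, h.2⟩
    rw [div_lt_iff₀ (by positivity)]
    rw [div_lt_iff₀ h.1] at hn
    nlinarith [h.1]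
  have hdir : Directed (· ⊆ ·) fun n : ℕ => Set.Ioc (s / ((n : ℝ) + 1)) s := by
    refine Monotone.directed_le fun m n hmn => Set.Ioc_subset_Ioc_left ?_
    gcongr
  rw [hU, setLIntegral_iUnion_of_directed _ hdir, ENNReal.add_iSup]
  refine iSup_le fun n => hstep _ ⟨by positivity, ?_⟩
  exact div_le_self hs0.le (by linarith [n.cast_nonneg (α := ℝ)])
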